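/- Let $k$ be a field and $r\ge 1$. All $k$-algebras are associative and unital, with $k$ central. An algebra augmented over $k^r$ is a $k$-algebra $H$ with $k$-algebra homomorphisms $\iota_H:k^r\to H$ and $\pi_H:H\to k^r$ such that $\pi_H\circ\iota_H=\mathrm{id}$; it is complete if, with $\mathfrak m=\ker\pi_H$, the canonical map $H\to\varprojlim_n H/\mathfrak m^n$ is bijective. A morphism $\psi:H\to S$ of such algebras is a $k$-algebra homomorphism with $\psi\circ\iota_H=\iota_S$ and $\pi_S\circ\psi=\pi_H$. The tangent algebra is $T=k^r\oplus V$, where $V=\bigoplus_{1\le i,j\le r}k\,t_{ij}$ is the $k^r$-bimodule with $e_it_{ij}e_j=t_{ij}$ and $V\cdot V=0$. Let $A$ be a $k$-algebra, let $M_1,\dots,M_r$ be simple right $A$-modules and $M=\bigoplus_{i=1}^rM_i$. For $H$ augmented over $k^r$ consider the $k$-algebra $\mathrm{End}_H(H\otimes_{k^r}M)$, where $H$ is a right $k^r$-module through $\iota_H$ and endomorphisms act from the right. A morphism $\psi:H\to S$ induces by base change a $k$-algebra homomorphism $\Pi(\psi):\mathrm{End}_H(H\otimes_{k^r}M)\to\mathrm{End}_S(S\otimes_{k^r}M)$,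 and likewise $\pi_H$ induces $\Pi(\pi_H):\mathrm{End}_H(H\otimes_{k^r}M)\to\bigoplus_{i=1}^r\mathrm{End}_k(M_i)$. A lift of $M$ to $H$ is a $k$-algebra homomorphism $\varphi:A\to\mathrm{End}_H(H\otimes_{k^r}M)$ such that $\Pi(\pi_H)\circ\varphi$ is the structure homomorphism $a\mapsto(m\mapsto ma)$ of the right $A$-modules $M_i$. A pre-completion of $A$ in $M$ is a complete algebra $\hat H$ augmented over $k^r$ that has a lift $\hat\rho$ of $M$ to $\hat H$ such that, for every complete algebra $S$ augmented over $k^r$ and every lift $\varphi$ of $M$ to $S$, there is a morphism $\psi:\hat H\to S$ with $\Pi(\psi)\circ\hat\rho=\varphi$, and this $\psi$ is unique if $S\cong T$. Suppose that $\hat H$ is a pre-completion of $A$ in $M$, and let $\hat O^A_M=\mathrm{End}_{\hat H}(\hat H\otimes_{k^r}M)$ be the completion of $A$ in $M$. Through $\Pi(\pi_{\hat H})$, each $M_i$ is a right $\hat O^A_M$-module and each dual space $M_i^*=\mathrm{Hom}_k(M_i,k)$ is a left $\hat O^A_M$-module, by $(f\xi)(m)=\xi(mf)$. Then: 1. $\hat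 O^A_M$ has exactly $r$ maximal two-sided ideals, i.e. it is $r$-pointed. 2. Each $M_i$ is a simple right $\hat O^A_M$-module, and every simple right $\hat O^A_M$-module is isomorphic to $M_i$ for exactly one $i$. 3. Each $M_i^*$ is a simple left $\hat O^A_M$-module, and every simple left $\hat O^A_M$-module is isomorphic to $M_i^*$ for exactly one $i$. -/

import Mathlib

open scoped TensorProduct

universe u v

/-- A `k`-algebra `H` augmented over `k^r`: `k`-algebra maps `ι : k^r → H` and `π : H → k^r` with
`π ∘ ι = id`.  The image of `ι` need not be central. -/
structure AugAlg (k : Type u) [Field k] (r : ℕ) where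
  carrier : Type u
  [ring : Ring carrier]
  [algebra : Algebra k carrier]
  ι : (Fin r → k) →ₐ[k] carrier
  π : carrier →ₐ[k] (Fin r → k)
  π_ι : ∀ c, π (ι c) = c

namespace AugAlg

variable {k : Type u} [Field k] {r : ℕ}

instance (H : AugAlg k r) : Ring H.carrier := H.ring

instance (H : AugAlg k r) : Algebra k H.carrier := H.algebra

/-- The augmentation ideal `𝔪 = ker π`; it is two-sided, so its powers as a left ideal are its
powers as a two-sided ideal. -/
def augIdeal (H : AugAlg k r) : Ideal H.carrier := RingHom.ker H.π

/-- `H` is complete: the canonical map from `H` to the inverse limit of the `H / 𝔪 ^ n` is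
injective (first clause) and surjective (second clause). -/
def IsComplete (H : AugAlg k r) : Prop :=
  (∀ x : H.carrier, (∀ n : ℕ, x ∈ H.augIdeal ^ n) → x = 0) ∧
  (∀ x : ℕ → H.carrier, (∀ n : ℕ, x (n + 1) - x n ∈ H.augIdeal ^ n) →
    ∃ y : H.carrier, ∀ n : ℕ, x n - y ∈ H.augIdeal ^ n)

/-- Morphisms of algebras augmented over `k^r`. -/
@[ext]
structure Hom (H S : AugAlg k r) where
  toAlgHom : H.carrier →ₐ[k] S.carrier
  map_ι : ∀ c, toAlgHom (H.ι c) = S.ι c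
  π_map : ∀ x, S.π (toAlgHom x) = H.π x

/-- The right `k^r`-module structure `h · c = h * ι c` of `H`, written as a module structure over
the commutative ring `k^r`; it is the one used in the tensor product `H ⊗_{k^r} M`. -/
instance rightModule (H : AugAlg k r) : Module (Fin r → k) H.carrier where
  smul c h := h * H.ι c
  one_smul h := by change h * H.ι 1 = h; simp
  mul_smul c d h := by
    change h * H.ι (c * d) = h * H.ι d * H.ι c
    rw [mul_comm c d, map_mul, mul_assoc]
  smul_zero c := by change 0 * H.ι c = 0; simp
  smul_add c x y := by change (x + y) * H.ι c = x * H.ι c + y * H.ι c; rw [add_mul]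
  add_smul c d x := by change x * H.ι (c + d) = x * H.ι c + x * H.ι d; rw [map_add, mul_add]
  zero_smul x := by change x * H.ι 0 = 0; simp

theorem smul_eq (H : AugAlg k r) (c : Fin r → k) (h : H.carrier) : c • h = h * H.ι c := rfl

instance (H : AugAlg k r) : SMulCommClass (Fin r → k) H.carrier H.carrier :=
  ⟨fun c h x => by simp [smul_eq, mul_assoc]⟩

instance (H : AugAlg k r) : SMulCommClass (Fin r → k) k H.carrier :=
  ⟨fun c h x => by simp [smul_eq]⟩

variable (M : Fin r → Type u) [∀ i, AddCommGroup (M i)] [∀ i, Module k (M i)]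

/-- The left `H`-module `H ⊗_{k^r} M`, for the `k^r`-module `M = ⨁ᵢ Mᵢ`. -/
abbrev Tens (H : AugAlg k r) : Type u := H.carrier ⊗[Fin r → k] (∀ i, M i)

instance (H : AugAlg k r) : IsScalarTower k H.carrier (Tens M H) :=
  TensorProduct.isScalarTower_left

instance (H : AugAlg k r) : SMulCommClass H.carrier k (Tens M H) where
  smul_comm h a x := by
    induction x using TensorProduct.induction_on with
    | zero => simp
    | add x y hx hy => simp only [smul_add, hx, hy]
    | tmul x m => simp [TensorProduct.smul_tmul']

/-- `Ô = End_H (H ⊗_{k^r} M)`.  Since the `Mᵢ` are right modules, endomorphisms act from the right,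
so that the product of `f` and `g` is "first `f`, then `g`". -/
abbrev EndAlg (H : AugAlg k r) : Type u := (Module.End H.carrier (Tens M H))ᵐᵒᵖ

variable {M}

theorem one_tmul_smul (H : AugAlg k r) (c : Fin r → k) (m : ∀ i, M i) :
    (1 : H.carrier) ⊗ₜ[Fin r → k] (c • m) = H.ι c • ((1 : H.carrier) ⊗ₜ[Fin r → k] m) := by
  rw [← TensorProduct.smul_tmul, TensorProduct.smul_tmul', smul_eq]
  simp

theorem tmul_eq_smul (H : AugAlg k r) (h : H.carrier) (m : ∀ i, M i) :
    h ⊗ₜ[Fin r → k] m = h • ((1 : H.carrier) ⊗ₜ[Fin r → k] m) := by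
  simp [TensorProduct.smul_tmul']

/-- A morphism `ψ` as a map of right `k^r`-modules. -/
def Hom.toRightLinear {H S : AugAlg k r} (ψ : Hom H S) :
    H.carrier →ₗ[Fin r → k] S.carrier where
  toFun := ψ.toAlgHom
  map_add' := map_add _
  map_smul' c x := by simp [smul_eq, ψ.map_ι]

/-- The map `ψ ⊗ 1 : H ⊗ M → S ⊗ M`. -/
def Hom.tens {H S : AugAlg k r} (ψ : Hom H S) : Tens M H →ₗ[Fin r → k] Tens M S :=
  LinearMap.rTensor _ ψ.toRightLinear

theorem Hom.tens_tmul {H S : AugAlg k r} (ψ : Hom H S) (h : H.carrier) (m : ∀ i, M i) :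
    ψ.tens (h ⊗ₜ[Fin r → k] m) = ψ.toAlgHom h ⊗ₜ[Fin r → k] m := rfl

theorem Hom.tens_smul {H S : AugAlg k r} (ψ : Hom H S) (h : H.carrier) (x : Tens M H) :
    ψ.tens (h • x) = ψ.toAlgHom h • ψ.tens x := by
  induction x using TensorProduct.induction_on with
  | zero => simp
  | add x y hx hy => simp only [smul_add, map_add, hx, hy]
  | tmul x m => simp [TensorProduct.smul_tmul', Hom.tens_tmul]

/-- The base change of an `H`-endomorphism `f` of `H ⊗ M` along `ψ : H → S`, under
`S ⊗_H (H ⊗ M) = S ⊗ M`: it sends `s ⊗ m` to `s • (ψ ⊗ 1) (f (1 ⊗ m))`. -/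
def Hom.baseChangeEnd {H S : AugAlg k r} (ψ : Hom H S) (f : Module.End H.carrier (Tens M H)) :
    Module.End S.carrier (Tens M S) where
  toFun := TensorProduct.liftAddHom
    { toFun := fun s =>
        { toFun := fun m => s • ψ.tens (f ((1 : H.carrier) ⊗ₜ[Fin r → k] m))
          map_zero' := by simp
          map_add' := fun m m' => by simp [TensorProduct.tmul_add] }
      map_zero' := by ext; simp
      map_add' := fun s t => by ext; simp [add_smul] }
    (fun c s m => by
      change (c • s) • ψ.tens (f ((1 : H.carrier) ⊗ₜ[Fin r → k] m)) =
        s • ψ.tens (f ((1 : H.carrier) ⊗ₜ[Fin r → k] (c • m)))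
      rw [one_tmul_smul, map_smul, ψ.tens_smul, ψ.map_ι, smul_eq, mul_smul])
  map_add' := map_add _
  map_smul' t x := by
    induction x using TensorProduct.induction_on with
    | zero => simp
    | add x y hx hy => simp only [smul_add, map_add, hx, hy]
    | tmul s m =>
      simp only [TensorProduct.smul_tmul', smul_eq_mul, RingHom.id_apply,
        TensorProduct.liftAddHom_tmul]
      exact mul_smul _ _ _

theorem Hom.baseChangeEnd_tmul {H S : AugAlg k r} (ψ : Hom H S)
    (f : Module.End H.carrier (Tens M H)) (s : S.carrier) (m : ∀ i, M i) :
    ψ.baseChangeEnd f (s ⊗ₜ[Fin r → k] m) =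
      s • ψ.tens (f ((1 : H.carrier) ⊗ₜ[Fin r → k] m)) := rfl

theorem Hom.baseChangeEnd_tens {H S : AugAlg k r} (ψ : Hom H S)
    (f : Module.End H.carrier (Tens M H)) (x : Tens M H) :
    ψ.baseChangeEnd f (ψ.tens x) = ψ.tens (f x) := by
  induction x using TensorProduct.induction_on with
  | zero => simp
  | add x y hx hy => simp only [map_add, hx, hy]
  | tmul h m =>
    rw [ψ.tens_tmul, ψ.baseChangeEnd_tmul, tmul_eq_smul H h m, map_smul, ψ.tens_smul]

/-- The endomorphisms of `S ⊗ M` are determined by their values on the `1 ⊗ m`. -/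
theorem end_ext {S : AugAlg k r} {f g : Module.End S.carrier (Tens M S)}
    (h : ∀ m : ∀ i, M i, f ((1 : S.carrier) ⊗ₜ[Fin r → k] m) = g (1 ⊗ₜ m)) : f = g := by
  ext x
  induction x using TensorProduct.induction_on with
  | zero => simp
  | add x y hx hy => simp only [map_add, hx, hy]
  | tmul s m => rw [tmul_eq_smul, map_smul, map_smul, h]

/-- The algebra homomorphism `Π(ψ) : End_H (H ⊗ M) → End_S (S ⊗ M)` given by base change. -/
def Hom.baseChange {H S : AugAlg k r} (ψ : Hom H S) : EndAlg M H →ₐ[k] EndAlg M S :=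
  AlgHom.ofLinearMap
    { toFun := fun f => MulOpposite.op (ψ.baseChangeEnd f.unop)
      map_add' := fun f g => by
        apply MulOpposite.unop_injective
        apply end_ext
        intro m
        simp [Hom.baseChangeEnd_tmul]
      map_smul' := fun a f => by
        apply MulOpposite.unop_injective
        apply end_ext
        intro m
        simp only [MulOpposite.unop_smul, MulOpposite.unop_op, RingHom.id_apply,
          Hom.baseChangeEnd_tmul, LinearMap.smul_apply, one_smul]
        rw [← algebraMap_smul H.carrier a, ψ.tens_smul, AlgHom.commutes, algebraMap_smul] }
    (by
      apply MulOpposite.unop_injective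
      apply end_ext
      intro m
      simp [Hom.baseChangeEnd_tmul, Hom.tens_tmul])
    (fun f g => by
      apply MulOpposite.unop_injective
      apply end_ext
      intro m
      simp [Hom.baseChangeEnd_tmul, Hom.baseChangeEnd_tens])

/-- The map `π ⊗ 1 : H ⊗ M → k^r ⊗ M = M`. -/
def augTens (H : AugAlg k r) : Tens M H →ₗ[Fin r → k] (∀ i, M i) :=
  TensorProduct.lift
    (LinearMap.mk₂ (Fin r → k) (fun (h : H.carrier) (m : ∀ i, M i) => H.π h • m)
      (fun h h' m => by simp [add_smul])
      (fun c h m => by rw [smul_eq, map_mul, H.π_ι, mul_comm, mul_smul])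
      (fun h m m' => by simp)
      (fun c h m => by rw [← mul_smul, ← mul_smul, mul_comm]))

theorem augTens_tmul (H : AugAlg k r) (h : H.carrier) (m : ∀ i, M i) :
    H.augTens (h ⊗ₜ[Fin r → k] m) = H.π h • m := rfl

theorem augTens_smul (H : AugAlg k r) (h : H.carrier) (x : Tens M H) :
    H.augTens (h • x) = H.π h • H.augTens x := by
  induction x using TensorProduct.induction_on with
  | zero => simp
  | add x y hx hy => simp only [smul_add, map_add, hx, hy]
  | tmul x m => simp [TensorProduct.smul_tmul', augTens_tmul, mul_smul]

theorem augTens_end (H : AugAlg k r) (f : Module.End H.carrier (Tens M H)) (x : Tens M H) :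
    H.augTens (f x) = H.augTens (f ((1 : H.carrier) ⊗ₜ[Fin r → k] H.augTens x)) := by
  induction x using TensorProduct.induction_on with
  | zero => simp
  | add x y hx hy => simp only [map_add, TensorProduct.tmul_add, hx, hy]
  | tmul h m =>
    rw [augTens_tmul, one_tmul_smul, tmul_eq_smul, map_smul f, map_smul f, augTens_smul,
      augTens_smul, H.π_ι]

theorem augTens_single (H : AugAlg k r) (f : Module.End H.carrier (Tens M H)) (i : Fin r)
    (m : M i) :
    H.augTens (f ((1 : H.carrier) ⊗ₜ[Fin r → k] Pi.single i m)) =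
      Pi.single i (H.augTens (f ((1 : H.carrier) ⊗ₜ[Fin r → k] Pi.single i m)) i) := by
  have h : (Pi.single i m : ∀ j, M j) = (Pi.single i 1 : Fin r → k) • Pi.single i m := by
    funext j
    by_cases hj : j = i
    · subst hj; simp
    · simp [hj]
  conv_lhs => rw [h, one_tmul_smul, map_smul, augTens_smul, H.π_ι]
  funext j
  by_cases hj : j = i
  · subst hj; simp
  · simp [hj]

/-- The `i`-th component `M i → M i` of the endomorphism of `k^r ⊗ M = M` induced by `f`. -/
def residueEnd (H : AugAlg k r) (i : Fin r) (f : Module.End H.carrier (Tens M H)) :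
    Module.End k (M i) where
  toFun m := H.augTens (f ((1 : H.carrier) ⊗ₜ[Fin r → k] Pi.single i m)) i
  map_add' m m' := by simp [Pi.single_add, TensorProduct.tmul_add]
  map_smul' a m := by
    have h : (Pi.single i (a • m) : ∀ j, M j) = (fun _ => a : Fin r → k) • Pi.single i m := by
      funext j
      by_cases hj : j = i
      · subst hj; simp
      · simp [hj]
    rw [h, one_tmul_smul, map_smul, augTens_smul, H.π_ι]
    rfl

theorem residueEnd_apply (H : AugAlg k r) (i : Fin r) (f : Module.End H.carrier (Tens M H))
    (m : M i) : H.residueEnd i f m =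
      H.augTens (f ((1 : H.carrier) ⊗ₜ[Fin r → k] Pi.single i m)) i := rfl

variable (M) in
/-- The `i`-th component `End_H (H ⊗ M) → End_k (M i)` of the algebra homomorphism
`Π(π) : End_H (H ⊗ M) → End_{k^r} (k^r ⊗ M) = ⨁ᵢ End_k (M i)`. -/
def residue (H : AugAlg k r) (i : Fin r) : EndAlg M H →ₐ[k] (Module.End k (M i))ᵐᵒᵖ :=
  AlgHom.ofLinearMap
    { toFun := fun f => MulOpposite.op (H.residueEnd i f.unop)
      map_add' := fun f g => by
        apply MulOpposite.unop_injective
        ext m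
        simp [residueEnd_apply]
      map_smul' := fun a f => by
        apply MulOpposite.unop_injective
        ext m
        simp only [MulOpposite.unop_smul, MulOpposite.unop_op, RingHom.id_apply,
          residueEnd_apply, LinearMap.smul_apply]
        rw [← algebraMap_smul H.carrier a, augTens_smul, AlgHom.commutes]
        rfl }
    (by
      apply MulOpposite.unop_injective
      ext m
      simp [residueEnd_apply, augTens_tmul])
    (fun f g => by
      apply MulOpposite.unop_injective
      ext m
      simp only [MulOpposite.unop_mul, MulOpposite.unop_op, Module.End.mul_apply,
        residueEnd_apply, LinearMap.coe_mk, AddHom.coe_mk]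
      rw [augTens_end, augTens_single, Pi.single_eq_same])

variable (k r) in
/-- The `k^r`-bimodule `V = (V i j)` with all `V i j = k`. -/
def TangentBimodule : Type u := Fin r → Fin r → k

instance : AddCommGroup (TangentBimodule k r) :=
  inferInstanceAs (AddCommGroup (Fin r → Fin r → k))

instance : Module k (TangentBimodule k r) :=
  inferInstanceAs (Module k (Fin r → Fin r → k))

instance : Module (Fin r → k) (TangentBimodule k r) where
  smul c x := fun i j => c i * x i j
  one_smul x := funext fun i => funext fun j => one_mul (x i j)
  mul_smul c d x := funext fun i => funext fun j => mul_assoc (c i) (d i) (x i j)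
  smul_zero c := funext fun i => funext fun _ => mul_zero (c i)
  smul_add c x y := funext fun i => funext fun j => mul_add (c i) (x i j) (y i j)
  add_smul c d x := funext fun i => funext fun j => add_mul (c i) (d i) (x i j)
  zero_smul x := funext fun i => funext fun j => zero_mul (x i j)

instance : Module (Fin r → k)ᵐᵒᵖ (TangentBimodule k r) where
  smul c x := fun i j => x i j * c.unop j
  one_smul x := funext fun i => funext fun j => mul_one (x i j)
  mul_smul c d x := funext fun i => funext fun j => (mul_assoc (x i j) (d.unop j) (c.unop j)).symm
  smul_zero c := funext fun _ => funext fun j => zero_mul (c.unop j)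
  smul_add c x y := funext fun i => funext fun j => add_mul (x i j) (y i j) (c.unop j)
  add_smul c d x := funext fun i => funext fun j => mul_add (x i j) (c.unop j) (d.unop j)
  zero_smul x := funext fun i => funext fun j => mul_zero (x i j)

instance : SMulCommClass (Fin r → k) (Fin r → k)ᵐᵒᵖ (TangentBimodule k r) :=
  ⟨fun c d x => funext fun i => funext fun j => (mul_assoc (c i) (x i j) (d.unop j)).symm⟩

instance : IsScalarTower k (Fin r → k) (TangentBimodule k r) :=
  ⟨fun a c x => funext fun i => funext fun j => mul_assoc a (c i) (x i j)⟩

instance : IsScalarTower k (Fin r → k)ᵐᵒᵖ (TangentBimodule k r) :=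
  ⟨fun a c x => funext fun i => funext fun j => mul_left_comm (x i j) a (c.unop j)⟩

variable (k r) in
/-- The `r × r` tangent algebra `T = F(V) / (ker π)² = k^r ⊕ V`, where `F(V)` is the tensor algebra
over `k^r` of the bimodule `V` with all `V i j = k`; the product of two elements of `V` is zero. -/
def tangent : AugAlg k r where
  carrier := TrivSqZeroExt (Fin r → k) (TangentBimodule k r)
  ι := TrivSqZeroExt.inlAlgHom k (Fin r → k) (TangentBimodule k r)
  π := TrivSqZeroExt.fstHom k (Fin r → k) (TangentBimodule k r)
  π_ι _ := rfl

variable (M)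

/-- `M i` as a right module over `Ô = End_H (H ⊗ M)`, through `Π(π)`. -/
def RightPoint (_H : AugAlg k r) (i : Fin r) : Type u := M i

instance (H : AugAlg k r) (i : Fin r) : AddCommGroup (RightPoint M H i) :=
  inferInstanceAs (AddCommGroup (M i))

instance (H : AugAlg k r) (i : Fin r) : Module (EndAlg M H)ᵐᵒᵖ (RightPoint M H i) :=
  Module.compHom (M i) ((RingEquiv.opOp (Module.End k (M i))).symm.toRingHom.comp
    (RingHom.op (residue M H i : EndAlg M H →+* (Module.End k (M i))ᵐᵒᵖ)))

/-- The dual space `Hom_k (M i, k)` as a left module over `Ô = End_H (H ⊗ M)`, through `Π(π)`: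
`(f • ξ) m = ξ (m · f)`. -/
def LeftPoint (_H : AugAlg k r) (i : Fin r) : Type u := Module.Dual k (M i)

instance (H : AugAlg k r) (i : Fin r) : AddCommGroup (LeftPoint M H i) :=
  inferInstanceAs (AddCommGroup (Module.Dual k (M i)))

instance (H : AugAlg k r) (i : Fin r) : Module (EndAlg M H) (LeftPoint M H i) where
  smul f ξ := LinearMap.comp (M₂ := M i) (show Module.Dual k (M i) from ξ)
    (residue M H i f).unop
  one_smul ξ := by
    change LinearMap.comp (M₂ := M i) _ (residue M H i 1).unop = _
    rw [map_one]; rfl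
  mul_smul f g ξ := by
    change LinearMap.comp (M₂ := M i) _ (residue M H i (f * g)).unop = _
    rw [map_mul]; rfl
  smul_zero f := LinearMap.zero_comp _
  smul_add f ξ ζ := LinearMap.add_comp _ _ _
  add_smul f g ξ := by
    change LinearMap.comp (M₂ := M i) _ (residue M H i (f + g)).unop = _
    rw [map_add]; exact LinearMap.comp_add _ _ _
  zero_smul ξ := by
    change LinearMap.comp (M₂ := M i) _ (residue M H i 0).unop = _
    rw [map_zero]; exact LinearMap.comp_zero _

variable (A : Type u) [Ring A] [Algebra k A] [∀ i, Module Aᵐᵒᵖ (M i)]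

/-- A `k`-algebra homomorphism `φ : A → End_H (H ⊗ M)` fits in the diagram over `⨁ᵢ End_k (M i)`:
its composite with `Π(π)` is the structure morphism `a ↦ (m ↦ m a)` of the right module `M`. -/
def IsLift {A : Type u} [Ring A] [Algebra k A] [∀ i, Module Aᵐᵒᵖ (M i)]
    (H : AugAlg k r) (φ : A →ₐ[k] EndAlg M H) : Prop :=
  ∀ (a : A) (i : Fin r) (m : M i), (residue M H i (φ a)).unop m = MulOpposite.op a • m

/-- `H` is a pre-completion of `A` in `M = ⨁ᵢ Mᵢ`: it is complete, and there is a lift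
`ρ : A → End_H (H ⊗ M)` such that every lift `φ : A → End_S (S ⊗ M)`, with `S` complete, is
`Π(ψ) ∘ ρ` for some morphism `ψ : H → S`, which is unique when `S` is isomorphic to the
tangent algebra. -/
def IsPreCompletion (H : AugAlg k r) : Prop :=
  H.IsComplete ∧
  ∃ ρ : A →ₐ[k] EndAlg M H, IsLift M H ρ ∧
    ∀ S : AugAlg k r, S.IsComplete → ∀ φ : A →ₐ[k] EndAlg M S, IsLift M S φ →
      (∃ ψ : Hom H S, ψ.baseChange.comp ρ = φ) ∧
      ((∃ θ : Hom S (tangent k r), Function.Bijective θ.toAlgHom) →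
        ∀ ψ ψ' : Hom H S, ψ.baseChange.comp ρ = φ → ψ'.baseChange.comp ρ = φ → ψ = ψ')

end AugAlg

/-! The ring `Ô = End_H (H ⊗ M)` is compared with its residue ring, the product of the `End_k (M
i)`. Three facts carry the proof.

The existence of a pre-completion forces every `M i` to be finite-dimensional
(`IsPreCompletion.finite`). For fixed `a` and `m`, the element `ρ a (1 ⊗ m)` is a finite sum of
tensors, so its images under all morphisms from `H` to the tangent algebra have their `t i
i`-coefficients in one finite-dimensional subspace of `M i`. Conjugating the trivial lift by `1 + t
i i ⊗ f`, with `f` of rank one, gives lifts in which this coefficient is any prescribed vector,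
unless `m` spans `M i`.

The map from `Ô` to the residue ring is surjective: `g ↦ 1 ⊗ g` is a section.

Its kernel lies in the Jacobson radical. Completeness puts `𝔪` in the radical of `H`; an `f` with
zero residue maps `H ⊗ M` into `𝔪 (H ⊗ M)`, so `1 - f` is surjective by Nakayama's lemma, and it
splits because `H ⊗ M` is projective.

Simple modules and maximal two-sided ideals are insensitive to an ideal inside the radical, so they
are those of a finite product of matrix algebras. `IsPointedFamily` isolates this last step, which
is applied to the `M i` over the opposite ring and to their duals over `Ô`. -/

/-- A family of modules `V i` over a ring `R`, all finite-dimensional over `k`, on which `R` acts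
as the full product of the `End_k (V i)`, the common annihilator being contained in the Jacobson
radical. -/
structure IsPointedFamily (k R : Type*) [Field k] [Ring R] {ι : Type*} (V : ι → Type*)
    [∀ i, AddCommGroup (V i)] [∀ i, Module k (V i)] [∀ i, Module R (V i)] : Prop where
  smulCommClass : ∀ i, SMulCommClass R k (V i)
  finite : ∀ i, Module.Finite k (V i)
  nontrivial : ∀ i, Nontrivial (V i)
  dense : ∀ g : ∀ i, V i →ₗ[k] V i, ∃ x : R, ∀ i v, x • v = g i v
  isUnit_one_sub : ∀ x : R, (∀ i, ∀ v : V i, x • v = 0) → IsUnit (1 - x)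

/-! ### Simple modules and maximal ideals of a ring with a pointed family -/

namespace IsPointedFamily

variable {k R : Type*} [Field k] [Ring R] {ι : Type*} {V : ι → Type*}
  [∀ i, AddCommGroup (V i)] [∀ i, Module k (V i)] [∀ i, Module R (V i)]

theorem exists_smul_eq (hV : IsPointedFamily k R V) (i : ι) (g : V i →ₗ[k] V i) :
    ∃ x : R, (∀ v : V i, x • v = g v) ∧ ∀ j, j ≠ i → ∀ v : V j, x • v = 0 := by
  classical
  obtain ⟨x, hx⟩ := hV.dense (Pi.single i g)
  refine ⟨x, fun v => by rw [hx, Pi.single_eq_same], fun j hj v => ?_⟩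
  rw [hx, Pi.single_eq_of_ne hj, LinearMap.zero_apply]

/-- Elements `e i` that act as the projections to the factors. -/
theorem exists_idempotents (hV : IsPointedFamily k R V) :
    ∃ e : ι → R, (∀ i, ∀ v : V i, e i • v = v) ∧ ∀ i j, j ≠ i → ∀ v : V j, e i • v = 0 := by
  choose e he he' using fun i => hV.exists_smul_eq i LinearMap.id
  exact ⟨e, he, he'⟩

/-- Elements acting on `V i` as the rank one maps `v ↦ ξ v • m`. -/
theorem exists_rankOne (hV : IsPointedFamily k R V) (i : ι) :
    ∃ E : Module.Dual k (V i) → V i → R, (∀ ξ m (v : V i), E ξ m • v = ξ v • m) ∧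
      ∀ ξ m j, j ≠ i → ∀ v : V j, E ξ m • v = 0 := by
  choose E hE hE' using fun (ξ : Module.Dual k (V i)) (m : V i) =>
    hV.exists_smul_eq i (ξ.smulRight m)
  exact ⟨E, hE, hE'⟩

theorem isSimpleModule (hV : IsPointedFamily k R V) (i : ι) : IsSimpleModule R (V i) := by
  have := hV.nontrivial i
  refine isSimpleModule_iff_toSpanSingleton_surjective.mpr ⟨inferInstance, fun v hv w => ?_⟩
  obtain ⟨ξ, hξ⟩ := Module.Projective.exists_dual_eq_one k hv
  obtain ⟨E, hE, -⟩ := hV.exists_rankOne i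
  exact ⟨E ξ w, by rw [LinearMap.toSpanSingleton_apply, hE, hξ, one_smul]⟩

theorem eq_of_equiv (hV : IsPointedFamily k R V) {i j : ι} (f : V i ≃ₗ[R] V j) : i = j := by
  by_contra hij
  have := hV.nontrivial i
  obtain ⟨v, hv⟩ := exists_ne (0 : V i)
  obtain ⟨e, he, he'⟩ := hV.exists_idempotents
  apply hv
  rw [← f.map_eq_zero_iff, ← he i v, map_smul, he' i j (Ne.symm hij)]

/-- The radical kills simple modules: if `x • n ≠ 0`, then `n = a • x • n` for some `a`, and the
unit `1 - a * x` annihilates `n`. -/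
theorem smul_eq_zero (hV : IsPointedFamily k R V) {N : Type*} [AddCommGroup N] [Module R N]
    [IsSimpleModule R N] {x : R} (hx : ∀ i, ∀ v : V i, x • v = 0) (n : N) : x • n = 0 := by
  by_contra hn
  obtain ⟨a, ha⟩ := IsSimpleModule.toSpanSingleton_surjective R hn n
  rw [LinearMap.toSpanSingleton_apply, ← mul_smul] at ha
  obtain ⟨w, hw⟩ := hV.isUnit_one_sub (a * x) fun i v => by rw [mul_smul, hx, smul_zero]
  have h : w • n = 0 := by
    rw [Units.smul_def, hw, sub_smul, one_smul, ha, sub_self]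
  rw [smul_eq_zero_iff_eq] at h
  exact hn (by rw [h, smul_zero])

theorem smul_congr (hV : IsPointedFamily k R V) {N : Type*} [AddCommGroup N] [Module R N]
    [IsSimpleModule R N] {x y : R} (h : ∀ i, ∀ v : V i, x • v = y • v) (n : N) :
    x • n = y • n := by
  rw [← sub_eq_zero, ← sub_smul]
  exact hV.smul_eq_zero (fun i v => by rw [sub_smul, h, sub_self]) n

theorem sum_smul [Fintype ι] {e : ι → R} (he : ∀ i, ∀ v : V i, e i • v = v)
    (he' : ∀ i j, j ≠ i → ∀ v : V j, e i • v = 0) (i : ι) (v : V i) : (∑ j, e j) • v = v := by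
  rw [Finset.sum_smul, Finset.sum_eq_single i (fun j _ hj => he' j i (Ne.symm hj) v) (by simp), he]

/-- On `N` the identity is the sum of the `e i`, and each `e i` is a sum of matrix units, so some
matrix unit does not kill `n`. Moving along its column gives a nonzero map `V i → N`, and Schur's
lemma applies. -/
theorem existsUnique_equiv [Fintype ι] (hV : IsPointedFamily k R V) (N : Type*) [AddCommGroup N]
    [Module R N] [IsSimpleModule R N] : ∃! i, Nonempty (N ≃ₗ[R] V i) := by
  have hN : Nontrivial N := IsSimpleModule.nontrivial R N
  obtain ⟨n, hn⟩ := exists_ne (0 : N)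
  obtain ⟨e, he, he'⟩ := hV.exists_idempotents
  obtain ⟨i, hi⟩ : ∃ i, e i • n ≠ 0 := by
    by_contra! h
    apply hn
    rw [← one_smul R n, ← hV.smul_congr (x := ∑ j, e j) (y := 1)
      (fun i v => by rw [sum_smul he he', one_smul]), Finset.sum_smul]
    exact Finset.sum_eq_zero fun i _ => h i
  have := hV.finite i
  have := hV.smulCommClass i
  have := hV.isSimpleModule i
  let b := Module.finBasis k (V i)
  obtain ⟨E, hE, hE'⟩ := hV.exists_rankOne i
  obtain ⟨l, hl⟩ : ∃ l, E (b.coord l) (b l) • n ≠ 0 := by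
    by_contra! h
    apply hi
    rw [hV.smul_congr (y := ∑ l, E (b.coord l) (b l)), Finset.sum_smul]
    · exact Finset.sum_eq_zero fun l _ => h l
    · intro j v
      rw [Finset.sum_smul]
      by_cases hj : j = i
      · subst hj
        rw [he]
        simp only [hE]
        exact (b.sum_repr v).symm
      · rw [he' i j hj, Finset.sum_eq_zero fun l _ => hE' _ _ j hj v]
  -- The functional stays fixed and the vector varies. Linearity holds because `x * E ξ m` and `E ξ
  -- (x • m)` act alike on all `V j`, hence on `N` by `smul_congr`.
  let φ : V i →ₗ[R] N :=
    { toFun := fun m => E (b.coord l) m • n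
      map_add' := fun m m' => by
        rw [← add_smul]
        refine hV.smul_congr (fun j v => ?_) n
        rw [add_smul]
        by_cases hj : j = i
        · subst hj
          rw [hE, hE, hE, smul_add]
        · rw [hE' _ _ j hj, hE' _ _ j hj, hE' _ _ j hj, add_zero]
      map_smul' := fun x m => by
        rw [RingHom.id_apply, ← mul_smul]
        refine hV.smul_congr (fun j v => ?_) n
        rw [mul_smul]
        by_cases hj : j = i
        · subst hj
          rw [hE, hE, smul_comm x]
        · rw [hE' _ _ j hj, hE' _ _ j hj, smul_zero] }
  have hφ : φ ≠ 0 := fun h => hl (LinearMap.congr_fun h (b l))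
  let ε := LinearEquiv.ofBijective φ (LinearMap.bijective_of_ne_zero hφ)
  exact ⟨i, ⟨ε.symm⟩, fun j ⟨f⟩ => (hV.eq_of_equiv (ε.trans f)).symm⟩

/-- The annihilator of `V i`. -/
def annihilator (R : Type*) [Ring R] (V : Type*) [AddCommGroup V] [Module R V] :
    TwoSidedIdeal R :=
  TwoSidedIdeal.ker (Module.toAddMonoidEnd R V)

theorem mem_annihilator {V : Type*} [AddCommGroup V] [Module R V] {x : R} :
    x ∈ annihilator R V ↔ ∀ v : V, x • v = 0 := by
  rw [annihilator, TwoSidedIdeal.mem_ker]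
  exact DFunLike.ext_iff

/-- Simplicity of a matrix algebra, modulo the common annihilator: a nonzero block at `i` generates
the identity block. -/
theorem mem_of_notMem_annihilator (hV : IsPointedFamily k R V) {I : TwoSidedIdeal R}
    (hI : ∀ x : R, (∀ i, ∀ v : V i, x • v = 0) → x ∈ I) {i : ι} {x : R} (hx : x ∈ I)
    (hxi : x ∉ annihilator R (V i)) {e : R} (he : ∀ v : V i, e • v = v)
    (he' : ∀ j, j ≠ i → ∀ v : V j, e • v = 0) : e ∈ I := by
  rw [mem_annihilator, not_forall] at hxi
  obtain ⟨v, hv⟩ := hxi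
  obtain ⟨ξ, hξ⟩ := Module.Projective.exists_dual_eq_one k hv
  have := hV.finite i
  have := hV.smulCommClass i
  let b := Module.finBasis k (V i)
  obtain ⟨E, hE, hE'⟩ := hV.exists_rankOne i
  -- As `ξ (x • v) = 1`, the `l`-th term acts on `V i` as `w ↦ b.coord l w • b l`, so the sum acts
  -- as the identity there and as zero on the other factors.
  have hz : ∑ l, E ξ (b l) * x * E (b.coord l) v ∈ I :=
    sum_mem fun l _ => I.mul_mem_right _ _ (I.mul_mem_left _ _ hx)
  rw [← sub_add_cancel e (∑ l, E ξ (b l) * x * E (b.coord l) v)]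
  refine I.add_mem (hI _ fun j w => ?_) hz
  rw [sub_smul, Finset.sum_smul, sub_eq_zero]
  simp only [mul_smul]
  by_cases hj : j = i
  · subst hj
    rw [he]
    simp only [hE, smul_comm x, map_smul, hξ, smul_eq_mul, mul_one]
    exact (b.sum_repr w).symm
  · rw [he' j hj]
    simp [hE' _ _ j hj]

theorem isCoatom_annihilator (hV : IsPointedFamily k R V) (i : ι) :
    IsCoatom (annihilator R (V i)) := by
  obtain ⟨e, he, he'⟩ := hV.exists_idempotents
  have := hV.nontrivial i
  obtain ⟨v, hv⟩ := exists_ne (0 : V i)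
  refine ⟨fun h => hv ?_, fun I hI => ?_⟩
  · rw [← TwoSidedIdeal.one_mem_iff, mem_annihilator] at h
    rw [← h v, one_smul]
  · obtain ⟨x, hx, hxi⟩ := Set.exists_of_ssubset ((TwoSidedIdeal.lt_iff _ _).mp hI)
    have hle : ∀ y, y ∈ annihilator R (V i) → y ∈ I := fun y hy => hI.le hy
    have h1 := hV.mem_of_notMem_annihilator (fun y hy => hle y (mem_annihilator.mpr (hy i))) hx hxi
      (he i) (he' i)
    rw [← TwoSidedIdeal.one_mem_iff, ← sub_add_cancel 1 (e i)]
    refine I.add_mem (hle _ (mem_annihilator.mpr fun w => ?_)) h1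
    rw [sub_smul, he, one_smul, sub_self]

theorem exists_eq_annihilator [Fintype ι] (hV : IsPointedFamily k R V) {I : TwoSidedIdeal R}
    (hI : IsCoatom I) : ∃ i, annihilator R (V i) = I := by
  obtain ⟨e, he, he'⟩ := hV.exists_idempotents
  -- A maximal two-sided ideal contains the common annihilator: otherwise `1 = y + z` with `y ∈ I`
  -- and `z` annihilating every `V i`, and `y = 1 - z` would be a unit.
  have hJ : ∀ x : R, (∀ i, ∀ v : V i, x • v = 0) → x ∈ I := by
    intro x hx
    by_contra hxI
    have hlt : I < I ⊔ ⨅ i, annihilator R (V i) := by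
      refine lt_of_le_of_ne le_sup_left fun h => hxI ?_
      rw [h]
      exact TwoSidedIdeal.mem_sup_right
        ((TwoSidedIdeal.mem_iInf R).mpr fun i => mem_annihilator.mpr (hx i))
    have h1 := (TwoSidedIdeal.one_mem_iff _).mpr (hI.2 _ hlt)
    obtain ⟨y, hy, z, hz, hyz⟩ := TwoSidedIdeal.mem_sup.mp h1
    obtain ⟨w, hw⟩ := hV.isUnit_one_sub z fun i =>
      mem_annihilator.mp ((TwoSidedIdeal.mem_iInf R).mp hz i)
    apply hI.1
    rw [← TwoSidedIdeal.one_mem_iff, ← w.inv_mul, hw, ← hyz, add_sub_cancel_right]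
    exact I.mul_mem_left _ _ hy
  obtain ⟨i, hi⟩ : ∃ i, e i ∉ I := by
    by_contra! h
    apply hI.1
    rw [← TwoSidedIdeal.one_mem_iff, ← sub_add_cancel 1 (∑ i, e i)]
    refine I.add_mem (hJ _ fun i v => ?_) (sum_mem fun i _ => h i)
    rw [sub_smul, sum_smul he he', one_smul, sub_self]
  have hle : I ≤ annihilator R (V i) := fun x hx => by
    by_contra hxi
    exact hi (hV.mem_of_notMem_annihilator hJ hx hxi (he i) (he' i))
  exact ⟨i, (hI.le_iff.mp hle).resolve_left (hV.isCoatom_annihilator i).1⟩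

theorem annihilator_injective (hV : IsPointedFamily k R V) :
    Function.Injective fun i => annihilator R (V i) := by
  intro i j hij
  by_contra hne
  obtain ⟨e, he, he'⟩ := hV.exists_idempotents
  have := hV.nontrivial j
  obtain ⟨v, hv⟩ := exists_ne (0 : V j)
  have h : e j ∈ annihilator R (V j) := by
    rw [← show annihilator R (V i) = annihilator R (V j) from hij]
    exact mem_annihilator.mpr (he' j i hne)
  exact hv (by rw [← he j v, mem_annihilator.mp h])

theorem encard_isCoatom [Fintype ι] (hV : IsPointedFamily k R V) :
    {I : TwoSidedIdeal R | IsCoatom I}.encard = Fintype.card ι := by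
  have h : {I : TwoSidedIdeal R | IsCoatom I} = (fun i => annihilator R (V i)) '' Set.univ := by
    rw [Set.image_univ]
    ext I
    constructor
    · exact hV.exists_eq_annihilator
    · rintro ⟨i, rfl⟩
      exact hV.isCoatom_annihilator i
  rw [h, hV.annihilator_injective.encard_image, Set.encard_univ, ENat.card_eq_coe_fintype_card]

end IsPointedFamily

/-! ### The kernel of the residue map lies in the Jacobson radical -/

/-- A class `p` of elements closed under left multiplication lies in the Jacobson radical as soon
as each `1 - f` with `p f` has a left inverse. -/
theorem isUnit_one_sub_of_exists_left_inverse {R : Type*} [Ring R] {p : R → Prop}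
    (hmul : ∀ g f, p f → p (g * f)) (hp : ∀ f, p f → ∃ g, g * (1 - f) = 1) {f : R} (hf : p f) :
    IsUnit (1 - f) := by
  obtain ⟨g, hg⟩ := hp f hf
  -- The left inverse `g` is again of the form `1 - f'` with `p f'`, so it has a left inverse too,
  -- which must be `1 - f`.
  have hg' : p (1 - g) := by
    have h : 1 - g = -g * f := by rw [← hg]; noncomm_ring
    rw [h]
    exact hmul _ _ hf
  obtain ⟨z, hz⟩ := hp _ hg'
  rw [sub_sub_cancel] at hz
  have hz' : z = 1 - f := left_inv_eq_right_inv hz hg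
  exact ⟨⟨1 - f, g, hz' ▸ hz, hg⟩, rfl⟩

namespace AugAlg

variable {k : Type u} [Field k] {r : ℕ} {M : Fin r → Type u} [∀ i, AddCommGroup (M i)]
  [∀ i, Module k (M i)]

theorem const_smul (S : AugAlg k r) (a : k) (x : Tens M S) : S.ι (fun _ => a) • x = a • x := by
  rw [← algebraMap_smul S.carrier a x, ← S.ι.commutes a]
  rfl

/-- The endomorphism of `S ⊗ M` that sends `s ⊗ m` to `s • g m`, for a `k^r`-semilinear map
`g : M → S ⊗ M`. -/
def endLift (S : AugAlg k r) (g : (∀ i, M i) →+ Tens M S)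
    (hg : ∀ (c : Fin r → k) m, g (c • m) = S.ι c • g m) : Module.End S.carrier (Tens M S) where
  toFun := TensorProduct.liftAddHom
    { toFun := fun s => (DistribSMul.toAddMonoidHom (Tens M S) s).comp g
      map_zero' := by ext; simp
      map_add' := fun s t => by ext; simp [add_smul] }
    (fun c s m => by
      change (c • s) • g m = s • g (c • m)
      rw [hg, smul_eq]
      exact mul_smul s (S.ι c) (g m))
  map_add' := map_add _
  map_smul' t x := by
    induction x using TensorProduct.induction_on with
    | zero => simp
    | add x y hx hy => simp only [smul_add, map_add, hx, hy]
    | tmul s m =>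
      simp only [TensorProduct.smul_tmul', smul_eq_mul, RingHom.id_apply,
        TensorProduct.liftAddHom_tmul]
      exact mul_smul t s (g m)

theorem endLift_one_tmul (S : AugAlg k r) (g : (∀ i, M i) →+ Tens M S)
    (hg : ∀ (c : Fin r → k) m, g (c • m) = S.ι c • g m) (m : ∀ i, M i) :
    S.endLift g hg (1 ⊗ₜ m) = g m :=
  one_smul S.carrier (g m)

/-- The endomorphism `1 ⊗ g` of `S ⊗ M`, for a family `g` of endomorphisms of the `M i`. -/
def constEnd (S : AugAlg k r) (g : ∀ i, Module.End k (M i)) : Module.End S.carrier (Tens M S) :=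
  S.endLift
    { toFun := fun m => 1 ⊗ₜ fun i => g i (m i)
      map_zero' := by simp only [Pi.zero_apply, map_zero]; exact TensorProduct.tmul_zero _ _
      map_add' := fun m m' => by
        rw [← TensorProduct.tmul_add]
        congr 1
        ext i
        simp }
    (fun c m => by
      change 1 ⊗ₜ (fun i => g i (c i • m i)) = _
      rw [AddMonoidHom.coe_mk, ZeroHom.coe_mk, ← one_tmul_smul]
      congr 1
      ext i
      simp)

theorem constEnd_one_tmul (S : AugAlg k r) (g : ∀ i, Module.End k (M i)) (m : ∀ i, M i) :
    S.constEnd g (1 ⊗ₜ m) = 1 ⊗ₜ fun i => g i (m i) :=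
  endLift_one_tmul _ _ _ _

theorem residue_constEnd (S : AugAlg k r) (g : ∀ i, Module.End k (M i)) (i : Fin r) :
    residue M S i (MulOpposite.op (S.constEnd g)) = MulOpposite.op (g i) := by
  apply MulOpposite.unop_injective
  ext m
  change S.augTens (S.constEnd g (1 ⊗ₜ Pi.single i m)) i = g i m
  rw [constEnd_one_tmul, augTens_tmul, map_one, one_smul, Pi.single_eq_same]

theorem augTens_eq_zero (S : AugAlg k r) {f : EndAlg M S} (hf : ∀ i, residue M S i f = 0)
    (x : Tens M S) : S.augTens (f.unop x) = 0 := by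
  have h : ∀ i (m : M i), S.augTens (f.unop (1 ⊗ₜ Pi.single i m)) = 0 := fun i m => by
    rw [augTens_single, ← residueEnd_apply]
    change Pi.single i ((residue M S i f).unop m) = 0
    rw [hf, MulOpposite.unop_zero, LinearMap.zero_apply, Pi.single_zero]
  rw [augTens_end, ← Finset.univ_sum_single (S.augTens x), TensorProduct.tmul_sum, map_sum, map_sum]
  exact Finset.sum_eq_zero fun i _ => h i _

/-- `x` and `1 ⊗ π x` agree modulo `𝔪 (S ⊗ M)`. -/
theorem sub_augTens_mem (S : AugAlg k r) (x : Tens M S) :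
    x - 1 ⊗ₜ S.augTens x ∈ S.augIdeal • (⊤ : Submodule S.carrier (Tens M S)) := by
  induction x using TensorProduct.induction_on with
  | zero => rw [map_zero, TensorProduct.tmul_zero, sub_zero]; exact zero_mem _
  | add x y hx hy =>
    rw [map_add, TensorProduct.tmul_add, add_sub_add_comm]
    exact add_mem hx hy
  | tmul s m =>
    have h : s ⊗ₜ m - 1 ⊗ₜ S.augTens (s ⊗ₜ m) =
        (s - S.ι (S.π s)) • ((1 : S.carrier) ⊗ₜ[Fin r → k] m : Tens M S) := by
      rw [augTens_tmul, one_tmul_smul, tmul_eq_smul]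
      exact (sub_smul (M := Tens M S) _ _ _).symm
    rw [h]
    refine Submodule.smul_mem_smul ?_ trivial
    rw [augIdeal, RingHom.mem_ker, map_sub, S.π_ι, sub_self]

instance (S : AugAlg k r) : S.augIdeal.IsTwoSided := inferInstanceAs (RingHom.ker S.π).IsTwoSided

/-- The geometric series of `w` converges to a left inverse by completeness. -/
theorem IsComplete.isUnit_one_sub {S : AugAlg k r} (hS : S.IsComplete) {w : S.carrier}
    (hw : w ∈ S.augIdeal) : IsUnit (1 - w) := by
  refine isUnit_one_sub_of_exists_left_inverse (p := (· ∈ S.augIdeal))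
    (fun g f hf => S.augIdeal.mul_mem_left g hf) (fun w hw => ?_) hw
  have hpow : ∀ n, w ^ n ∈ S.augIdeal ^ n := fun n => Ideal.pow_mem_pow hw n
  obtain ⟨y, hy⟩ := hS.2 (fun n => ∑ j ∈ Finset.range n, w ^ j) fun n => by
    rw [Finset.sum_range_succ, add_sub_cancel_left]
    exact hpow n
  refine ⟨y, sub_eq_zero.mp (hS.1 _ fun n => ?_)⟩
  have h : y * (1 - w) - 1 = -((∑ j ∈ Finset.range n, w ^ j - y) * (1 - w)) - w ^ n := by
    rw [sub_mul, geom_sum_mul_neg]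
    abel
  rw [h]
  exact sub_mem (neg_mem (Ideal.mul_mem_right _ _ (hy n))) (hpow n)

theorem IsComplete.augIdeal_le_jacobson {S : AugAlg k r} (hS : S.IsComplete) :
    S.augIdeal ≤ Ring.jacobson S.carrier := by
  rw [Ring.jacobson_eq_sInf_isMaximal]
  refine le_sInf fun I hI => ?_
  by_contra hle
  have h1 : (1 : S.carrier) ∈ I ⊔ S.augIdeal := by
    rw [Ideal.isMaximal_def.mp hI |>.2 _ (left_lt_sup.mpr hle)]
    trivial
  obtain ⟨y, hy, w, hw, hyw⟩ := Submodule.mem_sup.mp h1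
  refine hI.ne_top (Ideal.eq_top_of_isUnit_mem _ hy ?_)
  rw [eq_sub_of_add_eq hyw]
  exact hS.isUnit_one_sub hw

instance finite_tens (S : AugAlg k r) [∀ i, Module.Finite k (M i)] :
    Module.Finite S.carrier (Tens M S) := by
  obtain ⟨s, hs⟩ := (inferInstance : Module.Finite k (∀ i, M i))
  classical
  refine ⟨s.image fun m => (1 : S.carrier) ⊗ₜ m, eq_top_iff.mpr fun x _ => ?_⟩
  induction x using TensorProduct.induction_on with
  | zero => exact zero_mem _
  | add x y hx hy => exact add_mem (hx trivial) (hy trivial)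
  | tmul h m =>
    rw [tmul_eq_smul]
    refine Submodule.smul_mem _ _ ?_
    clear * - hs
    have hm : m ∈ Submodule.span k (s : Set (∀ i, M i)) := hs ▸ trivial
    induction hm using Submodule.span_induction with
    | mem m hm => exact Submodule.subset_span (by simpa using ⟨m, hm, rfl⟩)
    | zero => rw [TensorProduct.tmul_zero]; exact zero_mem _
    | add m m' _ _ hm hm' => rw [TensorProduct.tmul_add]; exact add_mem hm hm'
    | smul a m _ hm =>
      rw [show a • m = (fun _ : Fin r => a) • m from rfl, one_tmul_smul]
      exact Submodule.smul_mem _ _ hm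

/-- A surjective endomorphism of `S ⊗ M` has a section, since `S ⊗ M` is projective. -/
theorem exists_section (S : AugAlg k r) {f : Module.End S.carrier (Tens M S)}
    (hf : Function.Surjective f) : ∃ g : Module.End S.carrier (Tens M S), f * g = 1 := by
  obtain ⟨σ, hσ⟩ := LinearMap.exists_rightInverse_of_surjective (f.restrictScalars k)
    (LinearMap.range_eq_top.mpr hf)
  have hσ' : ∀ x, f (σ x) = x := fun x => LinearMap.congr_fun hσ x
  have hsingle : ∀ i, ∀ m : M i, S.ι (Pi.single i 1) • ((1 : S.carrier) ⊗ₜ[Fin r → k]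
      (Pi.single i m : ∀ j, M j) : Tens M S) = 1 ⊗ₜ Pi.single i m := fun i m => by
    rw [← one_tmul_smul]
    congr 1
    ext j
    by_cases hj : j = i
    · subst hj; simp
    · simp [hj]
  -- The section `σ` is only `k`-linear. Multiplying its value on the `i`-th component by the
  -- idempotent `ι (Pi.single i 1)` makes the map `k^r`-semilinear, and it remains a section since
  -- this idempotent fixes `1 ⊗ Pi.single i m`.
  refine ⟨S.endLift
    { toFun := fun m => ∑ i, S.ι (Pi.single i 1) • σ (1 ⊗ₜ Pi.single i (m i))
      map_zero' := by simp
      map_add' := fun m m' => by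
        simp [Pi.single_add, TensorProduct.tmul_add, Finset.sum_add_distrib] } ?_, ?_⟩
  · intro c m
    simp only [AddMonoidHom.coe_mk, ZeroHom.coe_mk, Finset.smul_sum]
    refine Finset.sum_congr rfl fun i _ => ?_
    have h1 : (Pi.single i ((c • m) i) : ∀ j, M j) = (fun _ => c i : Fin r → k) • Pi.single i (m i) := by
      ext j
      by_cases hj : j = i
      · subst hj; simp
      · simp [hj]
    have h2 : c * Pi.single i 1 = Pi.single i 1 * fun _ => c i := by
      ext j
      by_cases hj : j = i
      · subst hj; simp
      · simp [hj]
    rw [h1, one_tmul_smul, const_smul, map_smul, ← const_smul, ← mul_smul, ← mul_smul, ← map_mul,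
      ← map_mul, h2]
  · apply end_ext
    intro m
    rw [Module.End.mul_apply, endLift_one_tmul, Module.End.one_apply]
    simp only [AddMonoidHom.coe_mk, ZeroHom.coe_mk, map_sum, map_smul, hσ', hsingle]
    rw [← TensorProduct.tmul_sum, Finset.univ_sum_single]

/-- Nakayama's lemma makes `1 - f` surjective, hence split. As products in `EndAlg` are reversed,
the section is a left inverse. -/
theorem IsComplete.exists_left_inverse {S : AugAlg k r} (hS : S.IsComplete)
    [∀ i, Module.Finite k (M i)] {f : EndAlg M S} (hf : ∀ i, residue M S i f = 0) :
    ∃ g : EndAlg M S, g * (1 - f) = 1 := by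
  have hsurj : Function.Surjective (1 - f).unop := by
    rw [← LinearMap.range_eq_top]
    by_contra hne
    obtain ⟨N, hN, hle⟩ := (eq_top_or_exists_le_coatom _).resolve_left hne
    refine hN.1 (eq_top_iff.mpr fun x _ => ?_)
    have h1 : (1 - f).unop x ∈ N := hle (LinearMap.mem_range_self _ x)
    -- The image of `f` lies in `𝔪 (S ⊗ M)`, hence in the radical of `S ⊗ M`, hence in every maximal
    -- submodule.
    have h2 : f.unop x ∈ N := by
      have h := S.sub_augTens_mem (f.unop x)
      rw [S.augTens_eq_zero hf, TensorProduct.tmul_zero, sub_zero] at h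
      have h3 := Ring.jacobson_smul_top_le S.carrier (Tens M S)
        (Submodule.smul_mono_left hS.augIdeal_le_jacobson h)
      exact (sInf_le hN : Module.jacobson S.carrier (Tens M S) ≤ N) h3
    have h4 : x = (1 - f).unop x + f.unop x := by simp
    rw [h4]
    exact add_mem h1 h2
  obtain ⟨g, hg⟩ := S.exists_section hsurj
  exact ⟨MulOpposite.op g, MulOpposite.unop_injective hg⟩

theorem IsComplete.isUnit_one_sub_end {S : AugAlg k r} (hS : S.IsComplete)
    [∀ i, Module.Finite k (M i)] {f : EndAlg M S} (hf : ∀ i, residue M S i f = 0) :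
    IsUnit (1 - f) := by
  refine isUnit_one_sub_of_exists_left_inverse (p := fun f => ∀ i, residue M S i f = 0)
    (fun g f hf i => ?_) (fun f hf => hS.exists_left_inverse hf) hf
  exact (map_mul (residue M S i) g f).trans (by rw [hf, mul_zero])

instance (H : AugAlg k r) (i : Fin r) : Module k (RightPoint M H i) :=
  inferInstanceAs (Module k (M i))

instance (H : AugAlg k r) (i : Fin r) : Module k (LeftPoint M H i) :=
  inferInstanceAs (Module k (Module.Dual k (M i)))

theorem LeftPoint.smul_def (H : AugAlg k r) (i : Fin r) (f : EndAlg M H)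
    (ξ : LeftPoint M H i) : f • ξ = LinearMap.comp (M₂ := M i) ξ (residue M H i f).unop := rfl

theorem IsComplete.isPointedFamily_rightPoint {H : AugAlg k r} (hH : H.IsComplete)
    [∀ i, Module.Finite k (M i)] [∀ i, Nontrivial (M i)] :
    IsPointedFamily k (EndAlg M H)ᵐᵒᵖ (RightPoint M H) where
  smulCommClass i := ⟨fun f a m => map_smul (residue M H i f.unop).unop a m⟩
  finite i := inferInstanceAs (Module.Finite k (M i))
  nontrivial i := inferInstanceAs (Nontrivial (M i))
  dense g := ⟨MulOpposite.op (MulOpposite.op (H.constEnd (M := M) g)), fun i m => by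
    exact LinearMap.congr_fun (congrArg MulOpposite.unop (residue_constEnd (M := M) H g i)) m⟩
  isUnit_one_sub f hf := by
    exact IsUnit.op (hH.isUnit_one_sub_end (f := f.unop) fun i =>
      MulOpposite.unop_injective (LinearMap.ext (hf i)))

theorem IsComplete.isPointedFamily_leftPoint {H : AugAlg k r} (hH : H.IsComplete)
    [∀ i, Module.Finite k (M i)] [∀ i, Nontrivial (M i)] :
    IsPointedFamily k (EndAlg M H) (LeftPoint M H) where
  smulCommClass i := ⟨fun f a ξ => LinearMap.smul_comp a _ _⟩
  finite i := inferInstanceAs (Module.Finite k (Module.Dual k (M i)))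
  nontrivial i := inferInstanceAs (Nontrivial (Module.Dual k (M i)))
  dense g := by
    -- By finite dimension, every endomorphism of the dual is the transpose of an endomorphism of `M
    -- i`, found by biduality.
    let g' i : Module.End k (M i) := (Module.evalEquiv k (M i)).symm.toLinearMap ∘ₗ
      (show Module.Dual k (M i) →ₗ[k] Module.Dual k (M i) from g i).dualMap ∘ₗ
        Module.Dual.eval k (M i)
    refine ⟨MulOpposite.op (H.constEnd g'), fun i ξ => ?_⟩
    rw [LeftPoint.smul_def, residue_constEnd, MulOpposite.unop_op]
    exact LinearMap.ext fun m => Module.apply_evalEquiv_symm_apply k (M i) _ _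
  isUnit_one_sub f hf := hH.isUnit_one_sub_end fun i => MulOpposite.unop_injective <|
    LinearMap.ext fun m => (Module.forall_dual_apply_eq_zero_iff k _).mp fun ξ =>
      LinearMap.congr_fun (hf i ξ) m

end AugAlg

/-! ### Lifts to the tangent algebra and finite-dimensionality of the `M i` -/

/-- The conjugate `a ↦ u⁻¹ φ(a) u` of an algebra homomorphism. -/
def AlgHom.conjUnit {k A B : Type*} [CommSemiring k] [Semiring A] [Algebra k A] [Semiring B]
    [Algebra k B] (φ : A →ₐ[k] B) (u : Bˣ) : A →ₐ[k] B :=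
  AlgHom.ofLinearMap
    { toFun := fun a => ↑u⁻¹ * φ a * u
      map_add' := fun a b => by rw [map_add, mul_add, add_mul]
      map_smul' := fun c a => by rw [map_smul, mul_smul_comm, smul_mul_assoc, RingHom.id_apply] }
    (by simp)
    (fun a b => by simp [mul_assoc])

namespace AugAlg

variable {k : Type u} [Field k] {r : ℕ} {M : Fin r → Type u} [∀ i, AddCommGroup (M i)]
  [∀ i, Module k (M i)]

section Perturbation

variable (S : AugAlg k r) {t : S.carrier} (ht : ∀ c, t * S.ι c = S.ι c * t) (i : Fin r)

/-- The endomorphism `1 ⊗ m ↦ t ⊗ f (m i)` of `S ⊗ M`. -/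
def perturbation (f : Module.End k (M i)) : Module.End S.carrier (Tens M S) :=
  S.endLift
    { toFun := fun m => t ⊗ₜ Pi.single i (f (m i))
      map_zero' := by
        rw [Pi.zero_apply, map_zero, Pi.single_zero, TensorProduct.tmul_zero]
      map_add' := fun m m' => by
        rw [Pi.add_apply, map_add, Pi.single_add, TensorProduct.tmul_add] }
    (fun c m => by
      change t ⊗ₜ Pi.single i (f (c i • m i)) = S.ι c • (t ⊗ₜ Pi.single i (f (m i)))
      have h : (Pi.single i (f (c i • m i)) : ∀ j, M j) = c • Pi.single i (f (m i)) := by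
        rw [map_smul]
        ext j
        by_cases hj : j = i
        · subst hj; simp
        · simp [hj]
      rw [h, ← TensorProduct.smul_tmul, smul_eq, ht, TensorProduct.smul_tmul', smul_eq_mul])

theorem perturbation_one_tmul (f : Module.End k (M i)) (m : ∀ i, M i) :
    S.perturbation ht i f (1 ⊗ₜ m) = t ⊗ₜ Pi.single i (f (m i)) :=
  endLift_one_tmul _ _ _ _

theorem perturbation_mul (htt : t * t = 0) (f g : Module.End k (M i)) :
    S.perturbation ht i f * S.perturbation ht i g = 0 := by
  apply end_ext
  intro m
  rw [Module.End.mul_apply, perturbation_one_tmul, tmul_eq_smul, map_smul, perturbation_one_tmul,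
    TensorProduct.smul_tmul', smul_eq_mul, htt, TensorProduct.zero_tmul, LinearMap.zero_apply]

theorem one_add_perturbation_mul (htt : t * t = 0) {f g : Module.End k (M i)} (h : f + g = 0) :
    (1 + S.perturbation ht i f) * (1 + S.perturbation ht i g) = 1 := by
  have hN : S.perturbation ht i f + S.perturbation ht i g = 0 := by
    apply end_ext
    intro m
    rw [LinearMap.add_apply, perturbation_one_tmul, perturbation_one_tmul, ← TensorProduct.tmul_add,
      ← Pi.single_add, ← LinearMap.add_apply, h, LinearMap.zero_apply, Pi.single_zero,
      TensorProduct.tmul_zero, LinearMap.zero_apply]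
  rw [add_mul, one_mul, mul_add, mul_one, perturbation_mul _ _ _ htt, add_zero, add_assoc,
    add_comm (S.perturbation ht i g), hN, add_zero]

/-- The unit `1 + N` of `End_S (S ⊗ M)`, for `N` the perturbation of square zero. -/
def perturbationUnit (htt : t * t = 0) (f : Module.End k (M i)) : (EndAlg M S)ˣ where
  val := MulOpposite.op (1 + S.perturbation ht i f)
  inv := MulOpposite.op (1 + S.perturbation ht i (-f))
  val_inv := congrArg MulOpposite.op (S.one_add_perturbation_mul ht i htt (neg_add_cancel f))
  inv_val := congrArg MulOpposite.op (S.one_add_perturbation_mul ht i htt (add_neg_cancel f))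

theorem residue_perturbationUnit (hπ : S.π t = 0) (htt : t * t = 0) (f : Module.End k (M i))
    (j : Fin r) : residue M S j (S.perturbationUnit ht i htt f : EndAlg M S) = 1 := by
  apply MulOpposite.unop_injective
  ext m
  change S.augTens ((1 + S.perturbation ht i f) (1 ⊗ₜ Pi.single j m)) j = m
  rw [LinearMap.add_apply, perturbation_one_tmul, Module.End.one_apply, map_add, augTens_tmul,
    augTens_tmul, hπ, zero_smul, add_zero, map_one, one_smul, Pi.single_eq_same]

end Perturbation

theorem IsLift.conjUnit {A : Type u} [Ring A] [Algebra k A]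
    [∀ i, Module Aᵐᵒᵖ (M i)] {S : AugAlg k r} {φ : A →ₐ[k] EndAlg M S} (hφ : IsLift M S φ)
    {w : (EndAlg M S)ˣ} (hw : ∀ i, residue M S i w = 1) : IsLift M S (φ.conjUnit w) := by
  intro a i m
  have hw' : residue M S i ↑w⁻¹ = 1 := by
    have h := congrArg (residue M S i) w.mul_inv
    rwa [map_mul, hw, one_mul, map_one] at h
  have h : residue M S i (φ.conjUnit w a) = residue M S i (φ a) := by
    change residue M S i (↑w⁻¹ * φ a * w) = _
    rw [map_mul, map_mul, hw, hw', one_mul, mul_one]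
  rw [h]
  exact hφ a i m

section Lift

variable {A : Type u} [Ring A] [Algebra k A] [∀ i, Module Aᵐᵒᵖ (M i)]
  [∀ i, IsScalarTower k Aᵐᵒᵖ (M i)]

/-- The lift `a ↦ (1 ⊗ m ↦ 1 ⊗ m a)` of `M` to `S`. -/
def trivialLift (S : AugAlg k r) : A →ₐ[k] EndAlg M S :=
  have : ∀ i, SMulCommClass Aᵐᵒᵖ k (M i) := fun i => IsScalarTower.to_smulCommClass'
  AlgHom.ofLinearMap
    { toFun := fun a => MulOpposite.op
        (S.constEnd fun i => Module.toModuleEnd k (M i) (MulOpposite.op a))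
      map_add' := fun a b => by
        apply MulOpposite.unop_injective
        apply end_ext
        intro m
        simp only [MulOpposite.unop_op, MulOpposite.unop_add, LinearMap.add_apply,
          constEnd_one_tmul, ← TensorProduct.tmul_add, MulOpposite.op_add, map_add]
        rfl
      map_smul' := fun c a => by
        apply MulOpposite.unop_injective
        apply end_ext
        intro m
        rw [RingHom.id_apply, MulOpposite.unop_smul, LinearMap.smul_apply, MulOpposite.unop_op,
          MulOpposite.unop_op, constEnd_one_tmul, constEnd_one_tmul, ← const_smul, ← one_tmul_smul]
        congr 1
        ext i
        simp }
    (by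
      apply MulOpposite.unop_injective
      apply end_ext
      intro m
      simp [constEnd_one_tmul])
    (fun a b => by
      apply MulOpposite.unop_injective
      apply end_ext
      intro m
      simp [constEnd_one_tmul, mul_smul])

theorem trivialLift_apply (S : AugAlg k r) (a : A) (m : ∀ i, M i) :
    (S.trivialLift a : EndAlg M S).unop (1 ⊗ₜ m) = 1 ⊗ₜ fun i => MulOpposite.op a • m i :=
  constEnd_one_tmul _ _ _

theorem isLift_trivialLift (S : AugAlg k r) : IsLift M S (S.trivialLift (A := A)) := by
  intro a i m
  have : ∀ i, SMulCommClass Aᵐᵒᵖ k (M i) := fun i => IsScalarTower.to_smulCommClass'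
  exact LinearMap.congr_fun (congrArg MulOpposite.unop (S.residue_constEnd
    (fun i => Module.toModuleEnd k (M i) (MulOpposite.op a)) i)) m

end Lift

section Tangent

theorem isComplete_of_mul_eq_zero {S : AugAlg k r}
    (hS : ∀ x ∈ S.augIdeal, ∀ y ∈ S.augIdeal, x * y = 0) : S.IsComplete := by
  have h2 : ∀ n, 2 ≤ n → S.augIdeal ^ n = ⊥ := by
    intro n hn
    refine le_bot_iff.mp ((Ideal.pow_le_pow_right hn).trans ?_)
    rw [Submodule.pow_succ, Submodule.pow_one, Ideal.mul_le]
    exact fun x hx y hy => Ideal.mem_bot.mpr (hS x hx y hy)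
  -- The sequence is constant from index 2 on, because `𝔪 ^ n = 0` for `n ≥ 2`.
  refine ⟨fun x hx => ?_, fun x hx => ⟨x 2, fun n => ?_⟩⟩
  · have h := hx 2
    rwa [h2 2 le_rfl, Ideal.mem_bot] at h
  · obtain hn | hn := le_or_gt 2 n
    · have h : x n - x 2 = 0 := by
        induction n, hn using Nat.le_induction with
        | base => exact sub_self _
        | succ n hn ih =>
          have h := hx n
          rw [h2 n hn, Ideal.mem_bot] at h
          rw [← sub_add_sub_cancel, h, ih, add_zero]
      rw [h]
      exact zero_mem _
    · interval_cases n
      · rw [Submodule.pow_zero, Ideal.one_eq_top]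
        trivial
      · rw [← neg_sub]
        exact neg_mem (hx 1)

theorem isComplete_tangent : (tangent k r).IsComplete := by
  refine isComplete_of_mul_eq_zero fun x hx y hy => TrivSqZeroExt.ext ?_ ?_
  · change TrivSqZeroExt.fst x * TrivSqZeroExt.fst y = 0
    rw [show TrivSqZeroExt.fst x = 0 from hx, zero_mul]
  · change TrivSqZeroExt.fst x • TrivSqZeroExt.snd y +
      MulOpposite.op (TrivSqZeroExt.fst y) • TrivSqZeroExt.snd x = 0
    rw [show TrivSqZeroExt.fst x = 0 from hx, show TrivSqZeroExt.fst y = 0 from hy, zero_smul,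
      MulOpposite.op_zero, zero_smul, add_zero]

/-- The basis element `t i i` of the tangent algebra. -/
def tangentElem (i : Fin r) : (tangent k r).carrier :=
  TrivSqZeroExt.inr (R := Fin r → k) (M := TangentBimodule k r)
    (Pi.single i (Pi.single i 1) : Fin r → Fin r → k)

/-- This is where the diagonal position matters: both idempotents around `t i i` are the same. The
perturbation by `t i i` is well defined for this reason. -/
theorem tangentElem_mul_ι (i : Fin r) (c : Fin r → k) :
    tangentElem i * (tangent k r).ι c = (tangent k r).ι c * tangentElem i := by
  refine (TrivSqZeroExt.inr_mul_inl c _).trans (Eq.trans ?_ (TrivSqZeroExt.inl_mul_inr c _).symm)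
  refine congrArg TrivSqZeroExt.inr (funext fun a => funext fun b => ?_)
  change (Pi.single i (Pi.single i 1) : Fin r → Fin r → k) a b * c b =
    c a * (Pi.single i (Pi.single i 1) : Fin r → Fin r → k) a b
  by_cases ha : a = i
  · subst ha
    by_cases hb : b = a
    · subst hb
      rw [mul_comm]
    · simp [hb]
  · simp [ha]

theorem tangentElem_mul_self (i : Fin r) :
    tangentElem i * tangentElem i = (0 : (tangent k r).carrier) :=
  TrivSqZeroExt.inr_mul_inr _ _ _

/-- The coefficient map `T ⊗ M → M i` of `t i i`. -/
def tangentCoeff (i : Fin r) : Tens M (tangent k r) →+ M i :=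
  TensorProduct.liftAddHom
    { toFun := fun x =>
        { toFun := fun m => (TrivSqZeroExt.snd x : Fin r → Fin r → k) i i • m i
          map_zero' := by simp
          map_add' := fun m m' => by simp }
      map_zero' := by
        refine AddMonoidHom.ext fun m => ?_
        exact zero_smul k (m i)
      map_add' := fun x y => by
        refine AddMonoidHom.ext fun m => ?_
        exact add_smul (_ : k) _ (m i) }
    (fun c x m => by
      have h : (TrivSqZeroExt.snd (c • x) : Fin r → Fin r → k) i i =
          (TrivSqZeroExt.snd x : Fin r → Fin r → k) i i * c i := by
        refine congrFun (congrFun (TrivSqZeroExt.snd_mul (R := Fin r → k) (M := TangentBimodule k r)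
          x (TrivSqZeroExt.inl c)) i) i |>.trans ?_
        rw [TrivSqZeroExt.snd_inl, TrivSqZeroExt.fst_inl, smul_zero, zero_add]
        rfl
      change (TrivSqZeroExt.snd (c • x) : Fin r → Fin r → k) i i • m i =
        (TrivSqZeroExt.snd x : Fin r → Fin r → k) i i • c i • m i
      rw [h, mul_smul])

theorem tangentCoeff_tmul (i : Fin r) (x : (tangent k r).carrier) (m : ∀ i, M i) :
    tangentCoeff i (x ⊗ₜ m) = (TrivSqZeroExt.snd x : Fin r → Fin r → k) i i • m i := rfl

theorem tangentCoeff_one_tmul (i : Fin r) (m : ∀ i, M i) :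
    tangentCoeff i ((1 : (tangent k r).carrier) ⊗ₜ m) = 0 := by
  rw [tangentCoeff_tmul]
  exact zero_smul k (m i)

theorem tangentCoeff_tangentElem_tmul (i : Fin r) (m : ∀ i, M i) :
    tangentCoeff i (tangentElem (k := k) i ⊗ₜ m) = m i := by
  rw [tangentCoeff_tmul]
  change (Pi.single i (Pi.single i 1) : Fin r → Fin r → k) i i • m i = m i
  rw [Pi.single_eq_same, Pi.single_eq_same, one_smul]

/-- The images of a given tensor under all morphisms to the tangent algebra have their coefficients
in one finite-dimensional space. -/
theorem exists_fg_tangentCoeff_mem {H : AugAlg k r} (i : Fin r) (y : Tens M H) :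
    ∃ W : Submodule k (M i), W.FG ∧ ∀ ψ : Hom H (tangent k r), tangentCoeff i (ψ.tens y) ∈ W := by
  induction y using TensorProduct.induction_on with
  | zero => exact ⟨⊥, Submodule.fg_bot, fun ψ => by rw [map_zero, map_zero]; exact zero_mem _⟩
  | add x y hx hy =>
    obtain ⟨W, hW, h⟩ := hx
    obtain ⟨W', hW', h'⟩ := hy
    refine ⟨W ⊔ W', hW.sup hW', fun ψ => ?_⟩
    rw [map_add, map_add]
    exact Submodule.add_mem_sup (h ψ) (h' ψ)
  | tmul x m =>
    refine ⟨Submodule.span k {m i}, Submodule.fg_span_singleton _, fun ψ => ?_⟩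
    rw [ψ.tens_tmul, tangentCoeff_tmul]
    exact Submodule.smul_mem _ _ (Submodule.mem_span_singleton_self _)

end Tangent

/-- The lifts to the tangent algebra that are conjugate to the trivial one force the `M i` to be
finite-dimensional. -/
theorem IsPreCompletion.finite {A : Type u} [Ring A] [Algebra k A] [∀ i, Module Aᵐᵒᵖ (M i)]
    [∀ i, IsScalarTower k Aᵐᵒᵖ (M i)] {H : AugAlg k r} (hH : IsPreCompletion M A H) (i : Fin r)
    [IsSimpleModule Aᵐᵒᵖ (M i)] : Module.Finite k (M i) := by
  obtain ⟨-, ρ, -, hρ⟩ := hH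
  have hN : Nontrivial (M i) := IsSimpleModule.nontrivial Aᵐᵒᵖ (M i)
  obtain ⟨m, hm⟩ := exists_ne (0 : M i)
  -- If the line through `m` is stable under `A`, it is all of `M i` by simplicity. Otherwise some
  -- `m a` is independent of `m`, so an endomorphism can kill `m` and send `m a` to any given `w`.
  by_cases hspan : ∀ a : A, MulOpposite.op a • m ∈ Submodule.span k {m}
  · refine ⟨⟨{m}, eq_top_iff.mpr fun w _ => ?_⟩⟩
    obtain ⟨a, rfl⟩ := IsSimpleModule.toSpanSingleton_surjective Aᵐᵒᵖ hm w
    rw [Finset.coe_singleton]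
    exact hspan a.unop
  · push Not at hspan
    obtain ⟨a, ha⟩ := hspan
    obtain ⟨W, hW, hmem⟩ := exists_fg_tangentCoeff_mem i ((ρ a).unop (1 ⊗ₜ Pi.single i m))
    -- `W` is chosen before `w` and serves all morphisms `ψ` at once; each `w` yields its own lift
    -- and its own `ψ`.
    suffices h : W = ⊤ from ⟨h ▸ hW⟩
    refine eq_top_iff.mpr fun w _ => ?_
    obtain ⟨ξ, hξ, hle⟩ := Submodule.exists_le_ker_of_notMem ha
    have hξm : ξ m = 0 := hle (Submodule.mem_span_singleton_self m)
    let f : Module.End k (M i) := ((ξ (MulOpposite.op a • m))⁻¹ • ξ).smulRight w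
    have hfm : f m = 0 := by simp [f, hξm]
    have hfa : f (MulOpposite.op a • m) = w := by simp [f, hξ]
    let N : Module.End k (M i) → Module.End (tangent k r).carrier (Tens M (tangent k r)) :=
      (tangent k r).perturbation (tangentElem_mul_ι i) i
    have hN : ∀ g m, N g (1 ⊗ₜ m) = tangentElem i ⊗ₜ Pi.single i (g (m i)) :=
      perturbation_one_tmul _ _ _
    let p := (tangent k r).perturbationUnit (M := M) (tangentElem_mul_ι i) i
      (tangentElem_mul_self i) f
    obtain ⟨⟨ψ, hψ⟩, -⟩ := hρ (tangent k r) isComplete_tangent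
      (((tangent k r).trivialLift (M := M) (A := A)).conjUnit p)
      ((isLift_trivialLift _).conjUnit fun j => residue_perturbationUnit _ _ _ rfl _ _ _)
    have h := hmem ψ
    have h1 : ψ.tens ((ρ a).unop (1 ⊗ₜ Pi.single i m)) =
        (((tangent k r).trivialLift (M := M) (A := A)).conjUnit p a).unop (1 ⊗ₜ Pi.single i m) := by
      rw [← hψ]
      exact (one_smul (tangent k r).carrier _).symm
    -- The inner factor `1 + N (-f)` fixes `1 ⊗ m` because `f m = 0`; the outer factor then adds `t
    -- i i ⊗ f (m a) = t i i ⊗ w`.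
    have h2 : (((tangent k r).trivialLift (M := M) (A := A)).conjUnit p a).unop
        (1 ⊗ₜ Pi.single i m) =
        (1 ⊗ₜ fun j => MulOpposite.op a • (Pi.single i m : ∀ j, M j) j) +
          tangentElem i ⊗ₜ Pi.single i w := by
      change (1 + N f) (((tangent k r).trivialLift a : EndAlg M _).unop
        ((1 + N (-f)) (1 ⊗ₜ Pi.single i m))) = _
      have h3 : (1 + N (-f)) (1 ⊗ₜ Pi.single i m) = 1 ⊗ₜ Pi.single i m := by
        rw [LinearMap.add_apply, hN, Pi.single_eq_same, LinearMap.neg_apply, hfm, neg_zero,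
          Pi.single_zero, TensorProduct.tmul_zero, add_zero, Module.End.one_apply]
      rw [h3, trivialLift_apply, LinearMap.add_apply, hN, Pi.single_eq_same, hfa,
        Module.End.one_apply]
    rw [h1, h2, map_add, tangentCoeff_one_tmul, tangentCoeff_tangentElem_tmul, zero_add,
      Pi.single_eq_same] at h
    exact h

end AugAlg

/-! ### Points of the completion -/

theorem mainTheorem2 {k : Type u} [Field k] {A : Type u} [Ring A] [Algebra k A]
    {r : ℕ} (hr : 1 ≤ r)
    (M : Fin r → Type u) [∀ i, AddCommGroup (M i)] [∀ i, Module k (M i)]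
    [∀ i, Module Aᵐᵒᵖ (M i)] [∀ i, IsScalarTower k Aᵐᵒᵖ (M i)]
    (hM : ∀ i, IsSimpleModule Aᵐᵒᵖ (M i))
    (H : AugAlg k r) (hH : AugAlg.IsPreCompletion M A H) :
    {I : TwoSidedIdeal (AugAlg.EndAlg M H) | IsCoatom I}.encard = r ∧
    (∀ i, IsSimpleModule (AugAlg.EndAlg M H)ᵐᵒᵖ (AugAlg.RightPoint M H i)) ∧
    (∀ (N : Type v) [AddCommGroup N] [Module (AugAlg.EndAlg M H)ᵐᵒᵖ N],
      IsSimpleModule (AugAlg.EndAlg M H)ᵐᵒᵖ N →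
        ∃! i, Nonempty (N ≃ₗ[(AugAlg.EndAlg M H)ᵐᵒᵖ] AugAlg.RightPoint M H i)) ∧
    (∀ i, IsSimpleModule (AugAlg.EndAlg M H) (AugAlg.LeftPoint M H i)) ∧
    (∀ (N : Type v) [AddCommGroup N] [Module (AugAlg.EndAlg M H) N],
      IsSimpleModule (AugAlg.EndAlg M H) N →
        ∃! i, Nonempty (N ≃ₗ[AugAlg.EndAlg M H] AugAlg.LeftPoint M H i)) := by
  have hfin : ∀ i, Module.Finite k (M i) := fun i => hH.finite i
  have hnt : ∀ i, Nontrivial (M i) := fun i => IsSimpleModule.nontrivial Aᵐᵒᵖ (M i)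
  have hR := hH.1.isPointedFamily_rightPoint (M := M)
  have hL := hH.1.isPointedFamily_leftPoint (M := M)
  refine ⟨?_, hR.isSimpleModule, fun N _ _ _ => hR.existsUnique_equiv N, hL.isSimpleModule,
    fun N _ _ _ => hL.existsUnique_equiv N⟩
  rw [hL.encard_isCoatom, Fintype.card_fin]
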